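/- Let $p\ge 1$ be an integer and let $X\sim\mathcal N_p(\theta,I_p)$ with unknown mean $\theta\in\mathbb R^p$. Write $R(\theta,\hat\theta)=\mathrm E\|\hat\theta(X)-\theta\|^2$ for the quadratic risk of an estimator $\hat\theta$; call $\hat\theta$ minimax if $\sup_\theta R(\theta,\hat\theta)\le\sup_\theta R(\theta,\tilde\theta)$ for every (measurable) estimator $\tilde\theta$. Let $a>0$ and let $\phi$ be a real function that is weakly differentiable on $(0,\infty)$ with (essentially) bounded weak derivative $\phi'$, such that $0<\phi(w)\le w$ for $w\in(0,a)$ and $\phi(w)=0$ for $w\ge a$. Consider the debiased shrinkage estimator $$\hat\theta_\phi(X)=\Bigl(1-\frac{\phi(\|X\|^2)}{\|X\|^2}\Bigr)X ,$$ and the following two cases, in which statements about $\phi'$ are understood up to Lebesgue null sets: (Case 1) $\limsup_{w\nearrow a}\phi'(w)<0$; (Case 2) $\lim_{w\nearrow a}\phi'(w)=0$ and there exist $0<\epsilon<1$ and $\gamma>1$ such that $$-\gamma<(a-w)\frac{\phi'(w)}{\phi(w)}<-\frac1\gamma\qquad\text{for all } w\in(\epsilon a,a).$$ In either case $\hat\theta_\phi$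 is not minimax. Moreover $R(\theta,\hat\theta_\phi)$ is finite for every $\theta$ and, with $\nu=\|\theta\|^2$, $$\liminf_{\nu\to\infty}\frac{\nu^{(p+1)/4+b/2}\,e^{\nu/2}}{e^{\sqrt\nu\sqrt a}}\bigl\{R(\theta,\hat\theta_\phi)-p\bigr\}>0 ,$$ where $b=0$ in Case 1 and $b=\gamma-1$ in Case 2, for every $\gamma$ as there; in particular $R(\theta,\hat\theta_\phi)>p$ for all sufficiently large $\|\theta\|$. -/

import Mathlib

open MeasureTheory Filter Topology
open scoped ENNReal ContDiff

noncomputable section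

/-- `g` is a weak derivative of `f` on the open set `U ⊆ ℝ`: both are locally integrable on `U`, and
`∫_U f η' = - ∫_U g η` for every smooth `η` with compact support contained in `U`. -/
structure HasWeakDerivOn (f g : ℝ → ℝ) (U : Set ℝ) : Prop where
  locallyIntegrableOn : LocallyIntegrableOn f U volume
  locallyIntegrableOn_deriv : LocallyIntegrableOn g U volume
  integral_eq : ∀ η : ℝ → ℝ, ContDiff ℝ ∞ η → HasCompactSupport η → tsupport η ⊆ U →
    ∫ w in U, f w * deriv η w = - ∫ w in U, g w * η w

/-- The conditions on the shrinkage factor `φ` of a debiased shrinkage estimator with cut-off `a`;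
`φ'` is (a representative of) its weak derivative on `(0, ∞)`. -/
structure IsDebiasedFactor (φ φ' : ℝ → ℝ) (a : ℝ) : Prop where
  hasWeakDerivOn : HasWeakDerivOn φ φ' (Set.Ioi 0)
  bounded_deriv : ∃ C : ℝ, ∀ᵐ w ∂(volume : Measure ℝ), 0 < w → |φ' w| ≤ C
  pos : ∀ w ∈ Set.Ioo 0 a, 0 < φ w
  le_self : ∀ w ∈ Set.Ioo 0 a, φ w ≤ w
  eq_zero : ∀ w ∈ Set.Ici a, φ w = 0

/-- The filter `w ↗ a` up to Lebesgue null sets, the natural one for functions such as weak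
derivatives that are only determined almost everywhere. -/
def leftAE (a : ℝ) : Filter ℝ := 𝓝[<] a ⊓ ae volume

/-- The (essential) upper limit of `φ'` at `a` from the left is negative. -/
def NegativeSlope (φ' : ℝ → ℝ) (a : ℝ) : Prop :=
  limsup (fun w => (φ' w : EReal)) (leftAE a) < 0

/-- `φ'(w) → 0` as `w ↗ a`, and `-γ < (a - w) φ'(w) / φ(w) < -1/γ` on `(ε a, a)` for some
`0 < ε < 1`, where `γ > 1`. -/
structure FlatContact (φ φ' : ℝ → ℝ) (a γ : ℝ) : Prop where
  one_lt : 1 < γ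
  tendsto_zero : Tendsto φ' (leftAE a) (𝓝 0)
  bounds : ∃ ε : ℝ, 0 < ε ∧ ε < 1 ∧ ∀ᵐ w ∂(volume : Measure ℝ), w ∈ Set.Ioo (ε * a) a →
    -γ < (a - w) * (φ' w / φ w) ∧ (a - w) * (φ' w / φ w) < -(1 / γ)

/-- The estimator `(1 - φ(‖x‖²) / ‖x‖²) x`. -/
def shrinkageEstimator (p : ℕ) (φ : ℝ → ℝ) (x : EuclideanSpace ℝ (Fin p)) :
    EuclideanSpace ℝ (Fin p) :=
  (1 - φ (‖x‖ ^ 2) / ‖x‖ ^ 2) • x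

/-- The density at `x` of the normal distribution on `ℝᵖ` with mean `θ` and identity covariance. -/
def normalDensity {p : ℕ} (θ x : EuclideanSpace ℝ (Fin p)) : ℝ :=
  Real.exp (-‖x - θ‖ ^ 2 / 2) / (2 * Real.pi) ^ ((p : ℝ) / 2)

/-- The quadratic risk `E ‖δ(X) - θ‖²` of `δ` at `θ`, for `X` normal with mean `θ` and identity
covariance, as an extended nonnegative real. -/
def risk {p : ℕ} (δ : EuclideanSpace ℝ (Fin p) → EuclideanSpace ℝ (Fin p))
    (θ : EuclideanSpace ℝ (Fin p)) : ℝ≥0∞ :=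
  ∫⁻ x, ENNReal.ofReal (‖δ x - θ‖ ^ 2 * normalDensity θ x)

/-- `δ` is minimax: its maximal risk is least among the maximal risks of all (measurable)
estimators of `θ`. -/
def IsMinimax {p : ℕ} (δ : EuclideanSpace ℝ (Fin p) → EuclideanSpace ℝ (Fin p)) : Prop :=
  ∀ δ' : EuclideanSpace ℝ (Fin p) → EuclideanSpace ℝ (Fin p), AEMeasurable δ' volume →
    ⨆ θ, risk δ θ ≤ ⨆ θ, risk δ' θ

/-- The order `e^{√ν √a} / (ν^{(p+1)/4 + b/2} e^{ν/2})`. -/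
def excessOrder (p : ℕ) (a b ν : ℝ) : ℝ :=
  Real.exp (√ν * √a) / (ν ^ (((p : ℝ) + 1) / 4 + b / 2) * Real.exp (ν / 2))

/-- The risk of `δ` exceeds `p` by at least a positive constant times
`e^{√ν √a} / (ν^{(p+1)/4 + b/2} e^{ν/2})` for all large `ν = ‖θ‖²`. -/
def RiskExcess {p : ℕ} (δ : EuclideanSpace ℝ (Fin p) → EuclideanSpace ℝ (Fin p))
    (a b : ℝ) : Prop :=
  ∃ c : ℝ, 0 < c ∧ ∃ N : ℝ, 0 < N ∧ ∀ θ : EuclideanSpace ℝ (Fin p), N ≤ ‖θ‖ ^ 2 →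
    ENNReal.ofReal (p + c * excessOrder p a b (‖θ‖ ^ 2)) ≤ risk δ θ

end

/-! Write `k = φ(‖x‖²)/‖x‖²` and `t = ‖θ‖`. Expanding the square, the loss exceeds `‖x - θ‖²` by
`2k(⟪x, θ⟫ - ‖x‖²) + k²‖x‖²`, which vanishes for `‖x‖² ≥ a`. The normal density is `e^{-t²/2}` times
`e^{⟪x, θ⟫ - ‖x‖²/2}`, up to a constant. So only the ball of radius `√a` matters, and there the
weight strongly favours the points near `√a θ/t`, where the excess is positive for large `t`.

Negative contributions are harmless: since `z e^{-z} ≤ 1`, the weighted excess is bounded below on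
the ball uniformly in `θ` (`neg_two_mul_exp_le_excess`, `IsDebiasedFactor.le_risk`). For the
positive part it suffices to integrate over a box near `√a θ/t`, of length `1/t` along `θ` and of
width of order `t^{-1/2}` across it. There `a - ‖x‖²` is at least of order `1/t`, so a bound `φ(w) ≥
c(a - w)^γ` makes the excess at least of order `t^{-γ} · t` and the weight at least of order `e^{√a
t}`. Multiplied by the volume, this gives `e^{√a t} / t^{γ + (p-1)/2}`, the claimed order.

The bound on `φ` comes from recovering `φ` almost everywhere as a primitive of its weak derivative,
vanishing at `a`. A negative slope gives `γ = 1` by integration; in the flat case `φ(w)(a - w)^{-γ}`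
is nondecreasing. Non-minimaxity follows by comparison with `X` itself, whose risk is constantly
`p`. -/

/-! ### Weak derivatives and primitives on the half-line -/

theorem IsCompact.exists_subset_Ioo_of_subset_Ioi {K : Set ℝ} (hK : IsCompact K)
    (hK0 : K ⊆ Set.Ioi 0) {a : ℝ} (ha : 0 < a) :
    ∃ α B : ℝ, 0 < α ∧ α < a ∧ a < B ∧ K ⊆ Set.Ioo α B := by
  rcases K.eq_empty_or_nonempty with rfl | hne
  · exact ⟨a / 2, a + 1, by linarith, by linarith, by linarith, by simp⟩
  obtain ⟨m, hm, hml⟩ := hK.exists_isLeast hne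
  obtain ⟨M, hM, hMu⟩ := hK.exists_isGreatest hne
  have hm0 : 0 < m := hK0 hm
  refine ⟨min m a / 2, max M a + 1, by positivity, ?_, ?_, fun w hw => ⟨?_, ?_⟩⟩
  · have := min_le_right m a; linarith
  · have := le_max_right M a; linarith
  · have := hml hw
    have h2 := min_le_left m a
    have : 0 < min m a := lt_min hm0 ha
    linarith
  · have := hMu hw
    have h2 := le_max_left M a
    linarith

theorem setIntegral_Ioi_mul_eq_intervalIntegral {h η : ℝ → ℝ} {α B : ℝ} (hα : 0 < α) (hB : α ≤ B)
    (hη : Function.support η ⊆ Set.Ioo α B) :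
    ∫ w in Set.Ioi 0, h w * η w = ∫ w in α..B, h w * η w := by
  rw [intervalIntegral.integral_of_le hB]
  refine (setIntegral_eq_of_subset_of_forall_sdiff_eq_zero measurableSet_Ioi ?_ ?_)
  · intro w hw; exact hα.trans hw.1
  · rintro w ⟨-, hw⟩
    have : η w = 0 := by
      by_contra h0
      have := hη h0
      exact hw ⟨this.1, this.2.le⟩
    simp [this]

theorem ContDiff.absolutelyContinuousOnInterval_real {η : ℝ → ℝ} (h : ContDiff ℝ ∞ η) (α B : ℝ) :
    AbsolutelyContinuousOnInterval η α B :=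
  (h.of_le (by exact_mod_cast le_top)).contDiffOn.absolutelyContinuousOnInterval

theorem LocallyIntegrableOn.intervalIntegrable_of_Ioi {g : ℝ → ℝ}
    (hg : LocallyIntegrableOn g (Set.Ioi 0) volume) {α B : ℝ} (hα : 0 < α) (hB : 0 < B) :
    IntervalIntegrable g volume α B := by
  rw [intervalIntegrable_iff']
  refine hg.integrableOn_compact_subset ?_ isCompact_uIcc
  intro w hw
  exact (lt_min hα hB).trans_le hw.1

/-- The primitive of the weak derivative integrates by parts against test functions. -/
theorem setIntegral_primitive_mul_deriv {g η : ℝ → ℝ} {a : ℝ} (ha : 0 < a)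
    (hg : LocallyIntegrableOn g (Set.Ioi 0) volume)
    (hη : ContDiff ℝ ∞ η) (hc : HasCompactSupport η) (hs : tsupport η ⊆ Set.Ioi 0) :
    ∫ w in Set.Ioi 0, (∫ t in a..w, g t) * deriv η w = - ∫ w in Set.Ioi 0, g w * η w := by
  obtain ⟨α, B, hα, hαa, haB, hK⟩ := hc.isCompact.exists_subset_Ioo_of_subset_Ioi hs ha
  have hB : α ≤ B := by linarith
  have hs1 : Function.support η ⊆ Set.Ioo α B := (subset_tsupport η).trans hK
  have hs2 : Function.support (deriv η) ⊆ Set.Ioo α B := (support_deriv_subset).trans hK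
  have e1 := setIntegral_Ioi_mul_eq_intervalIntegral (h := fun w => ∫ t in a..w, g t) hα hB hs2
  rw [e1, setIntegral_Ioi_mul_eq_intervalIntegral hα hB hs1]
  have hgi := LocallyIntegrableOn.intervalIntegrable_of_Ioi hg hα (B := B) (by linarith)
  have haI : a ∈ Set.uIcc α B := by rw [Set.uIcc_of_le hB]; exact ⟨hαa.le, haB.le⟩
  have hF := hgi.absolutelyContinuousOnInterval_intervalIntegral haI
  rw [hF.integral_mul_deriv_eq_deriv_mul (hη.absolutelyContinuousOnInterval_real α B)]
  have z1 : η α = 0 := by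
    by_contra h; exact lt_irrefl _ (hs1 h).1
  have z2 : η B = 0 := by
    by_contra h; exact lt_irrefl _ (hs1 h).2
  rw [z1, z2]
  simp only [mul_zero, sub_zero, zero_sub, neg_inj]
  refine intervalIntegral.integral_congr_ae ?_
  filter_upwards [hgi.ae_hasDerivAt_integral] with w hw hw1
  rw [(hw (Set.uIoc_subset_uIcc hw1) a haI).deriv]

/-- A du Bois-Reymond lemma: a locally integrable function on `(0, ∞)` with zero weak derivative
that vanishes on `(a, ∞)` is zero. -/
theorem ae_eq_zero_of_setIntegral_mul_deriv_eq_zero {h : ℝ → ℝ} {a : ℝ} (ha : 0 < a)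
    (hh : LocallyIntegrableOn h (Set.Ioi 0) volume)
    (hz : ∀ᵐ w, a < w → h w = 0)
    (hw : ∀ η : ℝ → ℝ, ContDiff ℝ ∞ η → HasCompactSupport η → tsupport η ⊆ Set.Ioi 0 →
      ∫ w in Set.Ioi 0, h w * deriv η w = 0) :
    ∀ᵐ w, 0 < w → h w = 0 := by
  have key := isOpen_Ioi.ae_eq_zero_of_integral_contDiff_smul_eq_zero (U := Set.Ioi (0 : ℝ)) hh
  refine key fun ψ hψ hψc hψs => ?_
  -- A bump of mass one supported beyond `a`, where `h` vanishes. Subtracting a multiple of it from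
  -- `ψ` gives mean zero, hence a compactly supported primitive, without changing the integral
  -- against `h`.
  let β : ContDiffBump (a + 2) := ⟨1 / 2, 1, by norm_num, by norm_num⟩
  set ρ : ℝ → ℝ := β.normed volume with hρ
  have hρs : tsupport ρ ⊆ Set.Icc (a + 1) (a + 3) := by
    rw [hρ, β.tsupport_normed_eq, Real.closedBall_eq_Icc]
    exact Set.Icc_subset_Icc (by change _ ≤ a + 2 - 1; linarith) (by change a + 2 + 1 ≤ _; linarith)
  set m := ∫ w, ψ w with hm
  set κ : ℝ → ℝ := fun w => ψ w - m * ρ w with hκ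
  have hκd : ContDiff ℝ ∞ κ := hψ.sub (contDiff_const.mul β.contDiff_normed)
  have hψi : Integrable ψ := hψ.continuous.integrable_of_hasCompactSupport hψc
  have hρi : Integrable ρ := β.integrable_normed
  have hκ0 : ∫ w, κ w = 0 := by
    rw [hκ, integral_sub hψi (hρi.const_mul m), integral_const_mul, hρ, β.integral_normed, ← hm]
    ring
  obtain ⟨α, B, hα, hαa, haB, hK⟩ := hψc.isCompact.exists_subset_Ioo_of_subset_Ioi hψs
    (a := a + 4) (by linarith)
  have hα1 : min α a ≤ α := min_le_left _ _
  have hα2 : min α a ≤ a := min_le_right _ _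
  have hα0 : 0 < min α a := lt_min hα ha
  have hκs : Function.support κ ⊆ Set.Ioo (min α a) B := by
    intro w hw
    by_contra hcon
    apply hw
    have h1 : ψ w = 0 := by
      by_contra h0
      have := hK (subset_tsupport _ h0)
      exact hcon ⟨hα1.trans_lt this.1, this.2⟩
    have h2 : ρ w = 0 := by
      by_contra h0
      have := hρs (subset_tsupport _ h0)
      exact hcon ⟨by linarith [this.1], by linarith [this.2]⟩
    simp [hκ, h1, h2]
  set η : ℝ → ℝ := fun w => ∫ t in (0 : ℝ)..w, κ t with hη
  have hηd : ∀ w, HasDerivAt η (κ w) w := fun w =>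
    intervalIntegral.integral_hasDerivAt_right (hκd.continuous.intervalIntegrable _ _)
      (hκd.continuous.stronglyMeasurableAtFilter _ _) hκd.continuous.continuousAt
  have hηd' : deriv η = κ := funext fun w => (hηd w).deriv
  have hηC : ContDiff ℝ ∞ η := by
    rw [contDiff_infty_iff_deriv, hηd']
    exact ⟨fun w => (hηd w).differentiableAt, hκd⟩
  have hηs : Function.support η ⊆ Set.Icc (min α a) B := by
    intro w hw
    by_contra hcon
    apply hw
    have hcon' : w < min α a ∨ B < w := by
      by_contra h; push Not at h; exact hcon h
    rcases hcon' with h | h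
    · change ∫ t in (0 : ℝ)..w, κ t = 0
      refine intervalIntegral.integral_zero_ae (ae_of_all _ fun t ht => ?_)
      by_contra h0
      have h3 := hκs h0
      rcases Set.mem_uIoc.1 ht with h4 | h4 <;> linarith [h3.1, h4.2]
    · change ∫ t in (0 : ℝ)..w, κ t = 0
      rw [← hκ0]
      refine intervalIntegral.integral_eq_integral_of_support_subset fun t ht => ?_
      have h3 := hκs ht
      exact ⟨by linarith [h3.1], by linarith [h3.2]⟩
  have hηts : tsupport η ⊆ Set.Icc (min α a) B := closure_minimal hηs isClosed_Icc
  have h1 := hw η hηC (HasCompactSupport.intro isCompact_Icc fun w hw => by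
    by_contra h0; exact hw (hηs h0)) (hηts.trans fun w hw => hα0.trans_le hw.1)
  rw [hηd'] at h1
  have h2 : ∫ w in Set.Ioi 0, h w * κ w = ∫ w in Set.Ioi 0, h w * ψ w := by
    refine setIntegral_congr_ae measurableSet_Ioi ?_
    filter_upwards [hz] with w hw1 _
    by_cases hwa : a < w
    · simp [hw1 hwa]
    · have : ρ w = 0 := by
        by_contra h0
        have := hρs (subset_tsupport _ h0)
        linarith [this.1]
      simp [hκ, this]
  rw [h2] at h1
  rw [← h1, ← integral_indicator measurableSet_Ioi]
  congr 1
  ext w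
  by_cases hw0 : w ∈ Set.Ioi (0 : ℝ)
  · simp [Set.indicator_of_mem hw0, mul_comm]
  · have : ψ w = 0 := by
      by_contra h0
      exact hw0 (hψs (subset_tsupport _ h0))
    simp [this, Set.indicator_of_notMem hw0]

theorem continuousOn_primitive_Ioi {g : ℝ → ℝ} {a : ℝ} (ha : 0 < a)
    (hg : LocallyIntegrableOn g (Set.Ioi 0) volume) :
    ContinuousOn (fun w => ∫ t in a..w, g t) (Set.Ioi 0) := by
  intro w hw
  have hw : 0 < w := hw
  have h0 : 0 < min (w / 2) (a / 2) := by positivity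
  have l1 := min_le_left (w / 2) (a / 2)
  have l2 := min_le_right (w / 2) (a / 2)
  have l3 := le_max_left (w + 1) (a + 1)
  have l4 := le_max_right (w + 1) (a + 1)
  have hgi := LocallyIntegrableOn.intervalIntegrable_of_Ioi hg h0
    (B := max (w + 1) (a + 1)) (by positivity)
  have hle : min (w / 2) (a / 2) ≤ max (w + 1) (a + 1) := by linarith
  have haI : a ∈ Set.uIcc (min (w / 2) (a / 2)) (max (w + 1) (a + 1)) := by
    rw [Set.uIcc_of_le hle]; constructor <;> linarith
  have := (hgi.absolutelyContinuousOnInterval_intervalIntegral haI).continuousOn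
  rw [Set.uIcc_of_le hle] at this
  exact (this.continuousAt (Icc_mem_nhds (by linarith) (by linarith))).continuousWithinAt

/-- A function with a weak derivative on `(0, ∞)` that vanishes on `[a, ∞)` is the primitive of its
weak derivative. -/
theorem HasWeakDerivOn.ae_eq_primitive {f g : ℝ → ℝ} {a : ℝ} (ha : 0 < a)
    (hf : HasWeakDerivOn f g (Set.Ioi 0)) (hz : ∀ w ∈ Set.Ici a, f w = 0) :
    ∀ᵐ w, 0 < w → f w = ∫ t in a..w, g t := by
  -- The primitive based at `a` then also vanishes beyond `a`, which removes the additive constant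
  -- in du Bois-Reymond.
  have hg0 : ∀ᵐ w, w ∈ Set.Ioi a → g w = 0 := by
    refine isOpen_Ioi.ae_eq_zero_of_integral_contDiff_smul_eq_zero
      (hf.locallyIntegrableOn_deriv.mono_set (Set.Ioi_subset_Ioi ha.le)) ?_
    intro η hη hc hs
    have h1 := hf.integral_eq η hη hc (hs.trans (Set.Ioi_subset_Ioi ha.le))
    have h2 : ∫ w in Set.Ioi 0, f w * deriv η w = 0 := by
      refine (setIntegral_congr_fun measurableSet_Ioi fun w _ => ?_).trans (integral_zero _ _)
      by_cases hw : a ≤ w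
      · simp [hz w hw]
      · have : deriv η w = 0 := by
          by_contra h0
          exact hw (hs (support_deriv_subset h0)).le
        simp [this]
    rw [h2, zero_eq_neg] at h1
    rw [← h1, ← integral_indicator measurableSet_Ioi]
    congr 1
    ext w
    by_cases hw0 : w ∈ Set.Ioi (0 : ℝ)
    · simp [Set.indicator_of_mem hw0, mul_comm]
    · have : η w = 0 := by
        by_contra h0
        exact hw0 (ha.trans (hs (subset_tsupport _ h0)))
      simp [this, Set.indicator_of_notMem hw0]
  have hFc := continuousOn_primitive_Ioi ha hf.locallyIntegrableOn_deriv
  have hFl : LocallyIntegrableOn (fun w => ∫ t in a..w, g t) (Set.Ioi 0) volume :=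
    hFc.locallyIntegrableOn measurableSet_Ioi
  have := ae_eq_zero_of_setIntegral_mul_deriv_eq_zero (h := fun w => f w - ∫ t in a..w, g t) ha
    (hf.locallyIntegrableOn.sub hFl) ?_ ?_
  · filter_upwards [this] with w hw h0
    exact sub_eq_zero.1 (hw h0)
  · refine ae_of_all _ fun w hw => ?_
    have : ∫ t in a..w, g t = 0 := by
      refine intervalIntegral.integral_zero_ae ?_
      filter_upwards [hg0] with t ht ht1
      rw [Set.uIoc_of_le hw.le] at ht1
      exact ht ht1.1
    simp [this, hz w hw.le]
  · intro η hη hc hs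
    have hi : ∀ {u : ℝ → ℝ}, LocallyIntegrableOn u (Set.Ioi 0) volume →
        IntegrableOn (fun w => u w * deriv η w) (Set.Ioi 0) := by
      intro u hu
      have hd : Continuous (deriv η) := hη.continuous_deriv (by simp)
      have h1 : IntegrableOn (fun w => u w * deriv η w) (tsupport η) :=
        (hu.integrableOn_compact_subset hs hc.isCompact).mul_continuousOn hd.continuousOn
          hc.isCompact
      refine ((integrableOn_iff_integrable_of_support_subset ?_).1 h1).integrableOn
      intro w hw
      exact support_deriv_subset (right_ne_zero_of_mul hw)
    simp only [sub_mul]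
    rw [integral_sub (hi hf.locallyIntegrableOn) (hi hFl), hf.integral_eq η hη hc hs,
      setIntegral_primitive_mul_deriv ha hf.locallyIntegrableOn_deriv hη hc hs, sub_self]

/-! ### Lower bounds for the shrinkage factor near the cut-off -/

theorem eventually_leftAE_iff {P : ℝ → Prop} {a : ℝ} :
    (∀ᶠ w in leftAE a, P w) ↔ ∃ s < a, ∀ᵐ w, w ∈ Set.Ioo s a → P w := by
  constructor
  · intro h
    obtain ⟨u, hu, v, hv, huv⟩ := mem_inf_iff_superset.1 h
    obtain ⟨s, hs, hsu⟩ := (mem_nhdsLT_iff_exists_Ioo_subset' (show a - 1 < a by linarith)).1 hu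
    refine ⟨s, hs, ?_⟩
    filter_upwards [hv] with w hw hws
    exact huv ⟨hsu hws, hw⟩
  · rintro ⟨s, hs, h⟩
    have h1 : ∀ᶠ w in leftAE a, w ∈ Set.Ioo s a :=
      (show leftAE a ≤ 𝓝[<] a from inf_le_left) (Ioo_mem_nhdsLT hs)
    have h2 : ∀ᶠ w in leftAE a, w ∈ Set.Ioo s a → P w :=
      (show leftAE a ≤ ae volume from inf_le_right) h
    filter_upwards [h1, h2] with w hw1 hw2 using hw2 hw1

/-- If a primitive of `φ'` vanishing at `a` satisfies `-γ φ ≤ (a - w) φ'` to the left of `a`, then it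
is bounded below by a multiple of `(a - w) ^ γ` there. -/
theorem exists_mul_rpow_le_of_logDeriv {φ φ' : ℝ → ℝ} {a γ s : ℝ} (hs : 0 < s) (hsa : s < a)
    (hl : LocallyIntegrableOn φ' (Set.Ioi 0) volume)
    (hF : ∀ᵐ w, 0 < w → φ w = ∫ t in a..w, φ' t)
    (hpos : ∀ w ∈ Set.Ioo 0 a, 0 < φ w)
    (hb : ∀ᵐ w, w ∈ Set.Ioo s a → -γ * φ w ≤ (a - w) * φ' w) :
    ∃ c > 0, ∃ s' < a, ∀ᵐ w, w ∈ Set.Ioo s' a → c * (a - w) ^ γ ≤ φ w := by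
  -- The base point must avoid the null set where `φ` differs from its primitive; the constant below
  -- is the value of `φ(w)(a - w)^{-γ}` there.
  obtain ⟨w₀, hw₀, hφ₀⟩ : ∃ w ∈ Set.Ioo s a, 0 < w → φ w = ∫ t in a..w, φ' t := by
    by_contra! hcon
    have h0 : volume (Set.Ioo s a) = 0 := by
      refine measure_mono_null (fun w hw => ?_) hF
      have := hcon w hw
      simp only [Set.mem_compl_iff]
      intro h
      exact this.2 (h this.1)
    rw [Real.volume_Ioo, ENNReal.ofReal_eq_zero] at h0
    linarith
  have hw₀0 : 0 < w₀ := hs.trans hw₀.1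
  have hd0 : 0 < a - w₀ := by linarith [hw₀.2]
  refine ⟨φ w₀ * (a - w₀) ^ (-γ), mul_pos (hpos _ ⟨hw₀0, hw₀.2⟩) (Real.rpow_pos_of_pos hd0 _), w₀,
    hw₀.2, ?_⟩
  filter_upwards [hF] with w₁ hφ₁ hw₁
  have hd1 : 0 < a - w₁ := by linarith [hw₁.2]
  have hw₁0 : 0 < w₁ := hw₀0.trans hw₁.1
  have hle : w₀ ≤ w₁ := hw₁.1.le
  set F : ℝ → ℝ := fun w => ∫ t in a..w, φ' t with hFdef
  have hgi := LocallyIntegrableOn.intervalIntegrable_of_Ioi hl hw₀0 (hw₀0.trans hw₀.2) (B := a)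
  have haI : a ∈ Set.uIcc w₀ a := Set.right_mem_uIcc
  have hsub : Set.uIcc w₀ w₁ ⊆ Set.uIcc w₀ a := by
    rw [Set.uIcc_of_le hle, Set.uIcc_of_le hw₀.2.le]
    exact Set.Icc_subset_Icc_right hw₁.2.le
  have hFac : AbsolutelyContinuousOnInterval F w₀ w₁ :=
    (hgi.absolutelyContinuousOnInterval_intervalIntegral haI).mono hsub
  have hPac : AbsolutelyContinuousOnInterval (fun w => (a - w) ^ (-γ)) w₀ w₁ := by
    refine ContDiffOn.absolutelyContinuousOnInterval ?_
    refine ContDiffOn.rpow_const_of_ne (contDiff_const.sub contDiff_id).contDiffOn ?_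
    intro w hw
    rw [Set.uIcc_of_le hle] at hw
    have := hw.2
    exact ne_of_gt (by linarith)
  have hI := hFac.integral_deriv_mul_eq_sub hPac
  -- The integrand is `(a - w)^{-γ-1} ((a - w)φ' + γφ)` almost everywhere, so `F(w)(a - w)^{-γ}`
  -- does not decrease.
  have hnn : 0 ≤ ∫ w in w₀..w₁, deriv F w * (a - w) ^ (-γ) +
      F w * deriv (fun w => (a - w) ^ (-γ)) w := by
    refine intervalIntegral.integral_nonneg_of_ae_restrict hle ?_
    rw [EventuallyLE, ae_restrict_iff' measurableSet_Icc]
    filter_upwards [hgi.ae_hasDerivAt_integral, hF, hb, volume.ae_ne w₀] with w h1 h2 h3 hne hw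
    have hwa : 0 < a - w := by linarith [hw.2]
    have hw0 : 0 < w := hw₀0.trans_le hw.1
    have hwI : w ∈ Set.uIcc w₀ a := by
      rw [Set.uIcc_of_le hw₀.2.le]; exact ⟨hw.1, by linarith⟩
    rw [(h1 hwI a haI).deriv]
    have hd : HasDerivAt (fun w => (a - w) ^ (-γ)) (-1 * -γ * (a - w) ^ (-γ - 1)) w :=
      ((hasDerivAt_id w).const_sub a).rpow_const (Or.inl hwa.ne')
    rw [hd.deriv]
    have h2' : F w = φ w := (h2 hw0).symm
    have h3' := h3 ⟨by linarith [hw.1, hw₀.1], by linarith⟩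
    have e : (a - w) ^ (-γ) = (a - w) ^ (-γ - 1) * (a - w) := by
      rw [← Real.rpow_add_one hwa.ne']; ring_nf
    rw [h2', e]
    have : 0 ≤ (a - w) ^ (-γ - 1) := (Real.rpow_pos_of_pos hwa _).le
    have h4 : 0 ≤ (a - w) * φ' w + γ * φ w := by linarith
    simp only [Pi.zero_apply]
    nlinarith [mul_nonneg this h4]
  rw [hI, ← show φ w₁ = F w₁ from hφ₁ hw₁0, ← show φ w₀ = F w₀ from hφ₀ hw₀0] at hnn
  have h5 : (a - w₁) ^ (-γ) * (a - w₁) ^ γ = 1 := by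
    rw [← Real.rpow_add hd1]; simp
  have h6 : 0 < (a - w₁) ^ γ := Real.rpow_pos_of_pos hd1 _
  calc φ w₀ * (a - w₀) ^ (-γ) * (a - w₁) ^ γ ≤ φ w₁ * (a - w₁) ^ (-γ) * (a - w₁) ^ γ :=
        mul_le_mul_of_nonneg_right (by linarith) h6.le
    _ = φ w₁ := by rw [mul_assoc, h5, mul_one]

theorem IsDebiasedFactor.ae_eq_primitive {φ φ' : ℝ → ℝ} {a : ℝ} (ha : 0 < a)
    (hφ : IsDebiasedFactor φ φ' a) : ∀ᵐ w, 0 < w → φ w = ∫ t in a..w, φ' t :=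
  hφ.hasWeakDerivOn.ae_eq_primitive ha hφ.eq_zero

theorem FlatContact.exists_mul_rpow_le {φ φ' : ℝ → ℝ} {a γ : ℝ} (ha : 0 < a)
    (hφ : IsDebiasedFactor φ φ' a) (h : FlatContact φ φ' a γ) :
    ∃ c > 0, ∃ s < a, ∀ᵐ w, w ∈ Set.Ioo s a → c * (a - w) ^ γ ≤ φ w := by
  obtain ⟨ε, hε0, hε1, hb⟩ := h.bounds
  refine exists_mul_rpow_le_of_logDeriv (s := ε * a) (by positivity) (by nlinarith)
    hφ.hasWeakDerivOn.locallyIntegrableOn_deriv (hφ.ae_eq_primitive ha) hφ.pos ?_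
  filter_upwards [hb] with w hw hwI
  have hpos := hφ.pos w ⟨by have := hwI.1; nlinarith [mul_pos hε0 ha], hwI.2⟩
  have := (hw hwI).1
  rw [← mul_div_assoc, lt_div_iff₀ hpos] at this
  exact this.le

theorem NegativeSlope.exists_mul_le {φ φ' : ℝ → ℝ} {a : ℝ} (ha : 0 < a)
    (hφ : IsDebiasedFactor φ φ' a) (h : NegativeSlope φ' a) :
    ∃ c > 0, ∃ s < a, ∀ᵐ w, w ∈ Set.Ioo s a → c * (a - w) ≤ φ w := by
  obtain ⟨r, hr1, hr2⟩ := EReal.lt_iff_exists_real_btwn.1 h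
  have hr0 : r < 0 := by exact_mod_cast hr2
  obtain ⟨s, hs, hsb⟩ := eventually_leftAE_iff.1 (eventually_lt_of_limsup_lt hr1)
  refine ⟨-r, by linarith, max s 0, max_lt hs ha, ?_⟩
  filter_upwards [hφ.ae_eq_primitive ha] with w hw hwI
  have hw0 : 0 < w := (le_max_right s 0).trans_lt hwI.1
  have hws : s < w := (le_max_left s 0).trans_lt hwI.1
  have hi := LocallyIntegrableOn.intervalIntegrable_of_Ioi
    hφ.hasWeakDerivOn.locallyIntegrableOn_deriv hw0 ha
  rw [hw hw0, intervalIntegral.integral_symm]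
  have : ∫ t in w..a, φ' t ≤ ∫ _ in w..a, r := by
    refine intervalIntegral.integral_mono_ae_restrict hwI.2.le hi (by simp) ?_
    rw [EventuallyLE, ae_restrict_iff' measurableSet_Icc]
    filter_upwards [hsb, volume.ae_ne a] with t ht hne htI
    exact_mod_cast (ht ⟨by linarith [htI.1], lt_of_le_of_ne htI.2 hne⟩).le
  simp only [intervalIntegral.integral_const, smul_eq_mul] at this
  linarith

/-! ### Transfer of null sets from the half-line to the norm -/

theorem volume_setOf_sq_mem_eq_zero {N : Set ℝ} (hN : volume N = 0) (hN0 : N ⊆ Set.Ioi 0) :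
    volume {y : ℝ | 0 < y ∧ y ^ 2 ∈ N} = 0 := by
  refine measure_mono_null (t := Real.sqrt '' N) ?_ ?_
  · rintro y ⟨hy, hyN⟩
    exact ⟨y ^ 2, hyN, Real.sqrt_sq hy.le⟩
  · refine addHaar_image_eq_zero_of_differentiableOn_of_addHaar_eq_zero volume ?_ hN
    intro w hw
    have hw0 : 0 < w := hN0 hw
    exact (Real.hasDerivAt_sqrt hw0.ne').differentiableAt.differentiableWithinAt

/-- Polar coordinates: the indicator of a measurable null set containing the exceptional radii has
zero radial integral. -/
theorem ae_norm_of_ae_Ioi {E : Type*} [NormedAddCommGroup E] [NormedSpace ℝ E]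
    [FiniteDimensional ℝ E] [MeasurableSpace E] [BorelSpace E] [Nontrivial E] (μ : Measure E)
    [μ.IsAddHaarMeasure] {P : ℝ → Prop} (h : ∀ᵐ y, 0 < y → P y) : ∀ᵐ x ∂μ, P ‖x‖ := by
  have hne : ∀ᵐ x ∂μ, x ≠ 0 := by
    rw [ae_iff]; simp
  set T := toMeasurable volume {y : ℝ | ¬ (0 < y → P y)} with hT
  have hT0 : volume T = 0 := by rw [hT, measure_toMeasurable]; exact h
  have hTm : MeasurableSet T := measurableSet_toMeasurable _ _
  have hz : (fun y : ℝ => y ^ (Module.finrank ℝ E - 1) • T.indicator (fun _ => (1 : ℝ)) y)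
      =ᵐ[volume.restrict (Set.Ioi 0)] 0 := by
    refine ae_restrict_of_ae ?_
    filter_upwards [measure_eq_zero_iff_ae_notMem.1 hT0] with y hy
    simp [hy]
  have hi : Integrable (fun x : E => T.indicator (fun _ => (1 : ℝ)) ‖x‖) μ := by
    rw [integrable_fun_norm_addHaar μ (f := T.indicator (fun _ => (1 : ℝ)))]
    exact (integrable_zero _ _ _).congr hz.symm
  have h0 : ∫ x, T.indicator (fun _ => (1 : ℝ)) ‖x‖ ∂μ = 0 := by
    rw [integral_fun_norm_addHaar μ (T.indicator (fun _ => (1 : ℝ))), integral_congr_ae hz]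
    simp
  rw [integral_eq_zero_iff_of_nonneg (fun x => Set.indicator_nonneg (by simp) _) hi] at h0
  filter_upwards [h0, hne] with x hx hx0
  by_contra hP
  have : ‖x‖ ∈ T := subset_toMeasurable _ _ (by
    simp only [Set.mem_ofPred_eq, not_forall]
    exact ⟨norm_pos_iff.2 hx0, hP⟩)
  simp [this] at hx

theorem ae_norm_sq_of_ae_Ioi {E : Type*} [NormedAddCommGroup E] [NormedSpace ℝ E]
    [FiniteDimensional ℝ E] [MeasurableSpace E] [BorelSpace E] [Nontrivial E] (μ : Measure E)
    [μ.IsAddHaarMeasure] {P : ℝ → Prop} (h : ∀ᵐ w, 0 < w → P w) : ∀ᵐ x ∂μ, P (‖x‖ ^ 2) := by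
  refine ae_norm_of_ae_Ioi μ (P := fun y => P (y ^ 2)) ?_
  have := volume_setOf_sq_mem_eq_zero (N := {w | ¬ (0 < w → P w)}) h
    (fun w hw => (Classical.not_imp.1 hw).1)
  rw [ae_iff]
  refine measure_mono_null (fun y hy => ?_) this
  obtain ⟨hy0, hyP⟩ := Classical.not_imp.1 hy
  exact ⟨hy0, fun h => hyP (h (by positivity))⟩

/-! ### Gaussian moments and the risk of the identity -/

section Gaussian

variable {p : ℕ}

theorem integrableOn_pow_mul_exp_neg_sq_div_two (n : ℕ) :
    IntegrableOn (fun y : ℝ => y ^ n * Real.exp (-y ^ 2 / 2)) (Set.Ioi 0) := by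
  have := integrableOn_rpow_mul_exp_neg_mul_sq (b := 1 / 2) (by norm_num) (s := n)
    (by have : (0 : ℝ) ≤ n := n.cast_nonneg
        linarith)
  refine this.congr_fun (fun y _ => ?_) measurableSet_Ioi
  simp only [Real.rpow_natCast]
  congr 2; ring

theorem integral_pow_mul_exp_neg_sq_div_two (n : ℕ) :
    ∫ y in Set.Ioi (0 : ℝ), y ^ n * Real.exp (-y ^ 2 / 2) =
      (1 / 2 : ℝ) ^ (-((n : ℝ) + 1) / 2) * (1 / 2) * Real.Gamma (((n : ℝ) + 1) / 2) := by
  rw [← integral_rpow_mul_exp_neg_mul_rpow (p := 2) (q := n) (b := 1 / 2) (by norm_num)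
    (by have : (0 : ℝ) ≤ n := n.cast_nonneg
        linarith) (by norm_num)]
  refine setIntegral_congr_fun measurableSet_Ioi fun y _ => ?_
  simp only [Real.rpow_natCast, Real.rpow_two]
  congr 2; ring

theorem integral_pow_add_two_mul_exp_neg_sq_div_two (n : ℕ) :
    ∫ y in Set.Ioi (0 : ℝ), y ^ (n + 2) * Real.exp (-y ^ 2 / 2) =
      (n + 1) * ∫ y in Set.Ioi (0 : ℝ), y ^ n * Real.exp (-y ^ 2 / 2) := by
  rw [integral_pow_mul_exp_neg_sq_div_two, integral_pow_mul_exp_neg_sq_div_two]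
  have h0 : (0 : ℝ) < ((n : ℝ) + 1) / 2 := by positivity
  have e1 : (((n + 2 : ℕ) : ℝ) + 1) / 2 = ((n : ℝ) + 1) / 2 + 1 := by push_cast; ring
  have e2 : -(((n + 2 : ℕ) : ℝ) + 1) / 2 = -((n : ℝ) + 1) / 2 - 1 := by push_cast; ring
  rw [e1, e2, Real.Gamma_add_one h0.ne', Real.rpow_sub_one (by norm_num)]
  field_simp

theorem integral_norm_sq_mul_exp (hp : 1 ≤ p) :
    ∫ x : EuclideanSpace ℝ (Fin p), ‖x‖ ^ 2 * Real.exp (-‖x‖ ^ 2 / 2) =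
      p * (2 * Real.pi) ^ ((p : ℝ) / 2) := by
  have : Nonempty (Fin p) := ⟨⟨0, hp⟩⟩
  have hG : ∫ x : EuclideanSpace ℝ (Fin p), Real.exp (-‖x‖ ^ 2 / 2) =
      (2 * Real.pi) ^ ((p : ℝ) / 2) := by
    have := GaussianFourier.integral_rexp_neg_mul_sq_norm (V := EuclideanSpace ℝ (Fin p))
      (b := 1 / 2) (by norm_num)
    rw [finrank_euclideanSpace_fin] at this
    rw [show 2 * Real.pi = Real.pi / (1 / 2) by ring, ← this]
    congr 1; ext x; congr 1; ring
  rw [← hG, integral_fun_norm_addHaar volume (fun y : ℝ => y ^ 2 * Real.exp (-y ^ 2 / 2)),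
    integral_fun_norm_addHaar volume (fun y : ℝ => Real.exp (-y ^ 2 / 2)),
    finrank_euclideanSpace_fin]
  -- In polar coordinates the radial weight is `y^{p-1}`, so the Gamma recursion produces the factor
  -- `p`.
  have := integral_pow_add_two_mul_exp_neg_sq_div_two (p - 1)
  simp only [smul_eq_mul, ← mul_assoc, ← pow_add]
  rw [this]
  have : ((p - 1 : ℕ) : ℝ) + 1 = p := by
    rw [Nat.cast_sub hp]; push_cast; ring
  rw [this, nsmul_eq_mul, nsmul_eq_mul]
  ring

theorem integrable_norm_pow_mul_exp (hp : 1 ≤ p) (n : ℕ) :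
    Integrable fun x : EuclideanSpace ℝ (Fin p) => ‖x‖ ^ n * Real.exp (-‖x‖ ^ 2 / 2) := by
  have : Nonempty (Fin p) := ⟨⟨0, hp⟩⟩
  rw [integrable_fun_norm_addHaar volume (f := fun y : ℝ => y ^ n * Real.exp (-y ^ 2 / 2))]
  simp only [smul_eq_mul, ← mul_assoc, ← pow_add]
  exact integrableOn_pow_mul_exp_neg_sq_div_two _

theorem normalDensity_nonneg (θ x : EuclideanSpace ℝ (Fin p)) : 0 ≤ normalDensity θ x := by
  unfold normalDensity; positivity

theorem continuous_normalDensity (θ : EuclideanSpace ℝ (Fin p)) :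
    Continuous (normalDensity θ) := by
  unfold normalDensity; fun_prop

theorem integrable_norm_sub_pow_mul_normalDensity (hp : 1 ≤ p) (n : ℕ)
    (θ : EuclideanSpace ℝ (Fin p)) :
    Integrable fun x => ‖x - θ‖ ^ n * normalDensity θ x := by
  have := ((integrable_norm_pow_mul_exp hp n).comp_sub_right θ).div_const
    ((2 * Real.pi) ^ ((p : ℝ) / 2))
  refine this.congr (ae_of_all _ fun x => ?_)
  simp [normalDensity, mul_div_assoc]

theorem integral_norm_sub_sq_mul_normalDensity (hp : 1 ≤ p) (θ : EuclideanSpace ℝ (Fin p)) :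
    ∫ x, ‖x - θ‖ ^ 2 * normalDensity θ x = p := by
  have h1 : ∀ x : EuclideanSpace ℝ (Fin p), ‖x - θ‖ ^ 2 * normalDensity θ x =
      (fun y : EuclideanSpace ℝ (Fin p) =>
        ‖y‖ ^ 2 * Real.exp (-‖y‖ ^ 2 / 2) / (2 * Real.pi) ^ ((p : ℝ) / 2)) (x - θ) := by
    intro x; simp [normalDensity, mul_div_assoc]
  simp_rw [h1]
  rw [integral_sub_right_eq_self (fun y : EuclideanSpace ℝ (Fin p) =>
        ‖y‖ ^ 2 * Real.exp (-‖y‖ ^ 2 / 2) / (2 * Real.pi) ^ ((p : ℝ) / 2)),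
    integral_div, integral_norm_sq_mul_exp hp]
  have : (0 : ℝ) < (2 * Real.pi) ^ ((p : ℝ) / 2) := by positivity
  field_simp

theorem risk_id (hp : 1 ≤ p) (θ : EuclideanSpace ℝ (Fin p)) : risk id θ = p := by
  unfold risk
  rw [← ofReal_integral_eq_lintegral_ofReal
    (by simpa using integrable_norm_sub_pow_mul_normalDensity hp 2 θ)
    (ae_of_all _ fun x => mul_nonneg (by positivity) (normalDensity_nonneg θ x))]
  simp only [id]
  rw [integral_norm_sub_sq_mul_normalDensity hp]
  simp

end Gaussian

/-! ### Boxes along a given direction -/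

/-- A box with sides parallel to an orthonormal basis whose first vector is `e`. -/
theorem exists_box_along {p : ℕ} (hp : 1 ≤ p) {e : EuclideanSpace ℝ (Fin p)} (he : ‖e‖ = 1)
    {l r q : ℝ} (hlr : l ≤ r) (hq : 0 ≤ q) :
    ∃ A : Set (EuclideanSpace ℝ (Fin p)), MeasurableSet A ∧
      volume A = ENNReal.ofReal ((r - l) * (2 * q) ^ (p - 1)) ∧
      ∀ x ∈ A, l < inner ℝ x e ∧ inner ℝ x e < r ∧ (inner ℝ x e) ^ 2 ≤ ‖x‖ ^ 2 ∧
        ‖x‖ ^ 2 ≤ (inner ℝ x e) ^ 2 + p * q ^ 2 := by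
  obtain ⟨n, rfl⟩ : ∃ n, p = n + 1 := ⟨p - 1, by omega⟩
  have ho : Orthonormal ℝ (({0} : Set (Fin (n + 1))).domRestrict fun _ => e) := by
    refine ⟨fun _ => he, fun i j hij => ?_⟩
    exact absurd (Subsingleton.elim i j) hij
  obtain ⟨b, hb⟩ := ho.exists_orthonormalBasis_extension_of_card_eq
    (by rw [finrank_euclideanSpace_fin, Fintype.card_fin])
  have hb0 : b 0 = e := hb 0 rfl
  let lo : Fin (n + 1) → ℝ := Fin.cons l fun _ => -q
  let hi : Fin (n + 1) → ℝ := Fin.cons r fun _ => q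
  let T : EuclideanSpace ℝ (Fin (n + 1)) → (Fin (n + 1) → ℝ) := fun x => WithLp.ofLp (b.repr x)
  have hT : MeasurePreserving T :=
    (EuclideanSpace.volume_preserving_symm_measurableEquiv_toLp (Fin (n + 1))).comp
      b.measurePreserving_repr
  have hm : MeasurableSet (Set.univ.pi fun i => Set.Ioo (lo i) (hi i)) :=
    MeasurableSet.univ_pi fun _ => measurableSet_Ioo
  refine ⟨T ⁻¹' (Set.univ.pi fun i => Set.Ioo (lo i) (hi i)), hT.measurable hm, ?_, ?_⟩
  · rw [hT.measure_preimage hm.nullMeasurableSet, Real.volume_pi_Ioo, Fin.prod_univ_succ]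
    simp only [lo, hi, Fin.cons_zero, Fin.cons_succ, Finset.prod_const, Finset.card_univ,
      Fintype.card_fin, Nat.add_sub_cancel]
    rw [ENNReal.ofReal_mul (by linarith), ← ENNReal.ofReal_pow (by linarith)]
    ring_nf
  · intro x hx
    have hx' : ∀ i, T x i ∈ Set.Ioo (lo i) (hi i) := fun i => hx i trivial
    have h0 : T x 0 = inner ℝ x e := by
      change b.repr x 0 = _
      rw [b.repr_apply_apply, hb0, real_inner_comm]
    have hn : ‖x‖ ^ 2 = (inner ℝ x e) ^ 2 + ∑ i : Fin n, T x i.succ ^ 2 := by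
      rw [← b.repr.norm_map x, EuclideanSpace.norm_sq_eq, Fin.sum_univ_succ, ← h0]
      simp [T]
    have h1 := hx' 0
    rw [h0] at h1
    refine ⟨h1.1, h1.2, ?_, ?_⟩
    · rw [hn]
      exact le_add_of_nonneg_right (Finset.sum_nonneg fun i _ => sq_nonneg _)
    · rw [hn]
      have : ∑ i : Fin n, T x i.succ ^ 2 ≤ ∑ _i : Fin n, q ^ 2 :=
        Finset.sum_le_sum fun i _ => by
          have h2 := hx' i.succ
          simp only [lo, hi, Fin.cons_succ] at h2
          exact sq_le_sq' h2.1.le h2.2.le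
      simp only [Finset.sum_const, Finset.card_univ, Fintype.card_fin, nsmul_eq_mul] at this
      push_cast
      nlinarith [sq_nonneg q]

/-! ### Excess loss and a lower bound for the risk -/

section Estimator

variable {p : ℕ} {φ φ' : ℝ → ℝ} {a : ℝ}

theorem IsDebiasedFactor.div_mem (hφ : IsDebiasedFactor φ φ' a) {w : ℝ} (hw : 0 ≤ w) :
    0 ≤ φ w / w ∧ φ w / w ≤ 1 ∧ (a ≤ w → φ w / w = 0) := by
  rcases hw.eq_or_lt with rfl | hw0
  -- Nothing is assumed about `φ 0`; division by zero makes the quotient `0` there.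
  · simp
  rcases lt_or_ge w a with h | h
  · have h1 := hφ.pos w ⟨hw0, h⟩
    have h2 := hφ.le_self w ⟨hw0, h⟩
    exact ⟨by positivity, (div_le_one hw0).2 h2, fun h' => absurd h' (not_le.2 h)⟩
  · simp [hφ.eq_zero w h]

theorem norm_shrinkage_sub_sq (φ : ℝ → ℝ) (x θ : EuclideanSpace ℝ (Fin p)) :
    ‖shrinkageEstimator p φ x - θ‖ ^ 2 = ‖x - θ‖ ^ 2 +
      (2 * (φ (‖x‖ ^ 2) / ‖x‖ ^ 2) * (inner ℝ x θ - ‖x‖ ^ 2) +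
        (φ (‖x‖ ^ 2) / ‖x‖ ^ 2) ^ 2 * ‖x‖ ^ 2) := by
  unfold shrinkageEstimator
  rw [norm_sub_sq_real, norm_sub_sq_real, norm_smul, real_inner_smul_left, mul_pow,
    Real.norm_eq_abs, sq_abs]
  ring

theorem normalDensity_eq_mul_exp (θ x : EuclideanSpace ℝ (Fin p)) :
    normalDensity θ x = Real.exp (-‖θ‖ ^ 2 / 2) / (2 * Real.pi) ^ ((p : ℝ) / 2) *
      Real.exp (inner ℝ x θ - ‖x‖ ^ 2 / 2) := by
  unfold normalDensity
  rw [norm_sub_sq_real, div_mul_eq_mul_div, ← Real.exp_add]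
  ring_nf

theorem IsDebiasedFactor.norm_shrinkage_sub_sq_le (hφ : IsDebiasedFactor φ φ' a)
    (ha : 0 < a) (x θ : EuclideanSpace ℝ (Fin p)) :
    ‖shrinkageEstimator p φ x - θ‖ ^ 2 ≤ 2 * ‖x - θ‖ ^ 2 + 2 * a := by
  obtain ⟨h0, h1, h2⟩ := hφ.div_mem (sq_nonneg ‖x‖)
  set k := φ (‖x‖ ^ 2) / ‖x‖ ^ 2 with hk
  have e : shrinkageEstimator p φ x - θ = (x - θ) - k • x := by
    unfold shrinkageEstimator
    rw [← hk, sub_smul, one_smul]; abel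
  have hb : ‖k • x‖ ^ 2 ≤ a := by
    rw [norm_smul, mul_pow, Real.norm_eq_abs, sq_abs]
    rcases le_or_gt a (‖x‖ ^ 2) with h | h
    · rw [h2 h]; simpa using ha.le
    · have : k ^ 2 ≤ 1 := by nlinarith
      nlinarith [sq_nonneg ‖x‖]
  have h3 := parallelogram_law_with_norm ℝ (x - θ) (k • x)
  rw [e]
  nlinarith [sq_nonneg ‖x - θ + k • x‖]

/-- Local integrability makes `φ` only almost everywhere equal to a measurable function; composing
with `‖x‖²` is legitimate because null sets of the half-line pull back to null sets. -/
theorem IsDebiasedFactor.aestronglyMeasurable_shrinkage (hp : 1 ≤ p)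
    (hφ : IsDebiasedFactor φ φ' a) :
    AEStronglyMeasurable (shrinkageEstimator p φ) volume := by
  have : Nonempty (Fin p) := ⟨⟨0, hp⟩⟩
  have h1 : AEStronglyMeasurable φ (volume.restrict (Set.Ioi 0)) :=
    hφ.hasWeakDerivOn.locallyIntegrableOn.aestronglyMeasurable
  have h2 := h1.ae_eq_mk
  rw [EventuallyEq, ae_restrict_iff' measurableSet_Ioi] at h2
  have h3 := ae_norm_sq_of_ae_Ioi (volume : Measure (EuclideanSpace ℝ (Fin p)))
    (P := fun w => φ w = h1.mk φ w) h2
  have hg : Measurable (h1.mk φ) := h1.stronglyMeasurable_mk.measurable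
  refine AEStronglyMeasurable.congr (f := fun x => (1 - h1.mk φ (‖x‖ ^ 2) / ‖x‖ ^ 2) • x) ?_ ?_
  · have : Measurable fun x : EuclideanSpace ℝ (Fin p) =>
      (1 - h1.mk φ (‖x‖ ^ 2) / ‖x‖ ^ 2) • x := by fun_prop
    exact this.aestronglyMeasurable
  · filter_upwards [h3] with x hx
    simp [shrinkageEstimator, hx]

theorem IsDebiasedFactor.integrable_shrinkage (hp : 1 ≤ p) (ha : 0 < a)
    (hφ : IsDebiasedFactor φ φ' a) (θ : EuclideanSpace ℝ (Fin p)) :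
    Integrable fun x => ‖shrinkageEstimator p φ x - θ‖ ^ 2 * normalDensity θ x := by
  have hb : Integrable fun x => 2 * (‖x - θ‖ ^ 2 * normalDensity θ x) +
      2 * a * (‖x - θ‖ ^ 0 * normalDensity θ x) :=
    ((integrable_norm_sub_pow_mul_normalDensity hp 2 θ).const_mul 2).add
      ((integrable_norm_sub_pow_mul_normalDensity hp 0 θ).const_mul (2 * a))
  refine hb.mono' ?_ (ae_of_all _ fun x => ?_)
  · exact (((hφ.aestronglyMeasurable_shrinkage hp).sub aestronglyMeasurable_const).norm.pow 2).mul
      (continuous_normalDensity θ).aestronglyMeasurable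
  · have h := hφ.norm_shrinkage_sub_sq_le ha x θ
    have hd := normalDensity_nonneg θ x
    rw [Real.norm_of_nonneg (by positivity)]
    nlinarith [mul_le_mul_of_nonneg_right h hd]

theorem IsDebiasedFactor.risk_eq (hp : 1 ≤ p) (ha : 0 < a)
    (hφ : IsDebiasedFactor φ φ' a) (θ : EuclideanSpace ℝ (Fin p)) :
    risk (shrinkageEstimator p φ) θ =
      ENNReal.ofReal (∫ x, ‖shrinkageEstimator p φ x - θ‖ ^ 2 * normalDensity θ x) := by
  unfold risk
  rw [ofReal_integral_eq_lintegral_ofReal (hφ.integrable_shrinkage hp ha θ)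
    (ae_of_all _ fun x => mul_nonneg (by positivity) (normalDensity_nonneg θ x))]

/-- Only `w > u` can be negative, and then `(w - u)e^{-(w - u)} ≤ 1` while the remaining factor is
`e^{w/2} ≤ e^{a/2}`. The bound is independent of `u`, hence of `θ`. -/
theorem neg_two_mul_exp_le_excess {k w u a : ℝ} (hk0 : 0 ≤ k) (hk1 : k ≤ 1) (hw0 : 0 ≤ w)
    (hwa : w ≤ a) :
    -(2 * Real.exp (a / 2)) ≤ (2 * k * (u - w) + k ^ 2 * w) * Real.exp (u - w / 2) := by
  have he := Real.exp_pos (u - w / 2)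
  have ha := Real.exp_pos (a / 2)
  have h1 : 0 ≤ k ^ 2 * w * Real.exp (u - w / 2) := by positivity
  rcases le_or_gt w u with h | h
  · have : 0 ≤ 2 * k * (u - w) * Real.exp (u - w / 2) := by
      have : 0 ≤ u - w := by linarith
      positivity
    nlinarith
  · have e : Real.exp (u - w / 2) = Real.exp (-(w - u)) * Real.exp (w / 2) := by
      rw [← Real.exp_add]; ring_nf
    have h2 : (w - u) * Real.exp (-(w - u)) ≤ 1 := by
      have := Real.add_one_le_exp (w - u)
      rw [Real.exp_neg, ← div_eq_mul_inv, div_le_one (Real.exp_pos _)]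
      linarith
    have h3 : (w - u) * Real.exp (u - w / 2) ≤ Real.exp (a / 2) := by
      rw [e, ← mul_assoc]
      calc _ ≤ 1 * Real.exp (w / 2) := mul_le_mul_of_nonneg_right h2 (Real.exp_pos _).le
        _ ≤ _ := by rw [one_mul]; exact Real.exp_le_exp.2 (by linarith)
    have h4 : 0 ≤ (w - u) * Real.exp (u - w / 2) := mul_nonneg (by linarith) he.le
    nlinarith

/-- If the excess of the loss over `‖x - θ‖²`, weighted by `exp (⟪x, θ⟫ - ‖x‖² / 2)`, is at least
`m` on a set `A`, then the risk exceeds `p` by a multiple of `m` times the volume of `A`, up to a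
loss that is bounded in `θ`. -/
theorem IsDebiasedFactor.le_risk (hp : 1 ≤ p) (ha : 0 < a)
    (hφ : IsDebiasedFactor φ φ' a) (θ : EuclideanSpace ℝ (Fin p))
    {A : Set (EuclideanSpace ℝ (Fin p))} (hA : MeasurableSet A) (hAf : volume A ≠ ⊤) {m : ℝ}
    (hm : ∀ᵐ x, x ∈ A → m ≤ (2 * (φ (‖x‖ ^ 2) / ‖x‖ ^ 2) * (inner ℝ x θ - ‖x‖ ^ 2) +
        (φ (‖x‖ ^ 2) / ‖x‖ ^ 2) ^ 2 * ‖x‖ ^ 2) * Real.exp (inner ℝ x θ - ‖x‖ ^ 2 / 2)) :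
    ENNReal.ofReal (p + Real.exp (-‖θ‖ ^ 2 / 2) / (2 * Real.pi) ^ ((p : ℝ) / 2) *
      (m * volume.real A - 2 * Real.exp (a / 2) *
        volume.real (Metric.ball (0 : EuclideanSpace ℝ (Fin p)) (√a)))) ≤
      risk (shrinkageEstimator p φ) θ := by
  rw [hφ.risk_eq hp ha θ]
  apply ENNReal.ofReal_le_ofReal
  set Z := Real.exp (-‖θ‖ ^ 2 / 2) / (2 * Real.pi) ^ ((p : ℝ) / 2) with hZ
  have hZ0 : 0 ≤ Z := by positivity
  set B := Metric.ball (0 : EuclideanSpace ℝ (Fin p)) (√a) with hB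
  have hBm : MeasurableSet B := measurableSet_ball
  set K := 2 * Real.exp (a / 2) with hK
  have hK0 : 0 < K := by positivity
  have hBf : volume B ≠ ⊤ := measure_ball_lt_top.ne
  have iA : Integrable (A.indicator fun _ => Z * m) (volume : Measure (EuclideanSpace ℝ (Fin p))) :=
    (integrable_indicator_iff hA).2 (integrableOn_const hAf)
  have iB : Integrable (B.indicator fun _ => Z * K) (volume : Measure (EuclideanSpace ℝ (Fin p))) :=
    (integrable_indicator_iff hBm).2 (integrableOn_const hBf)
  have i0 := integrable_norm_sub_pow_mul_normalDensity hp 2 θ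
  have iAB : Integrable fun x => A.indicator (fun _ => Z * m) x - B.indicator (fun _ => Z * K) x :=
    iA.sub iB
  have e : p + Z * (m * volume.real A - K * volume.real B) =
      ∫ x, (‖x - θ‖ ^ 2 * normalDensity θ x +
        (A.indicator (fun _ => Z * m) x - B.indicator (fun _ => Z * K) x)) := by
    rw [integral_add i0 iAB, integral_norm_sub_sq_mul_normalDensity hp,
      integral_sub iA iB, integral_indicator_const _ hA, integral_indicator_const _ hBm]
    simp only [smul_eq_mul]
    ring
  rw [e]
  refine integral_mono_ae (i0.add iAB) (hφ.integrable_shrinkage hp ha θ) ?_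
  filter_upwards [hm] with x hx
  obtain ⟨h0, h1, h2⟩ := hφ.div_mem (sq_nonneg ‖x‖)
  have hmem : x ∈ B ↔ ‖x‖ ^ 2 < a := by
    rw [hB, mem_ball_zero_iff, Real.lt_sqrt (norm_nonneg x)]
  rw [norm_shrinkage_sub_sq, add_mul]
  have hN : normalDensity θ x = Z * Real.exp (inner ℝ x θ - ‖x‖ ^ 2 / 2) :=
    normalDensity_eq_mul_exp θ x
  set k := φ (‖x‖ ^ 2) / ‖x‖ ^ 2
  set D := 2 * k * (inner ℝ x θ - ‖x‖ ^ 2) + k ^ 2 * ‖x‖ ^ 2 with hD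
  set G := Real.exp (inner ℝ x θ - ‖x‖ ^ 2 / 2) with hG
  -- On `A` the bound `m` applies, and the ball term only weakens it; on the ball off `A` the
  -- uniform bound applies; elsewhere `k = 0`.
  suffices h : A.indicator (fun _ => Z * m) x - B.indicator (fun _ => Z * K) x ≤ Z * (D * G) by
    rw [hN]
    linarith
  have hBi : 0 ≤ B.indicator (fun _ => Z * K) x :=
    Set.indicator_nonneg (fun _ _ => by positivity) x
  by_cases hxA : x ∈ A
  · rw [Set.indicator_of_mem hxA]
    have := mul_le_mul_of_nonneg_left (hx hxA) hZ0
    linarith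
  · rw [Set.indicator_of_notMem hxA]
    by_cases hxB : x ∈ B
    · rw [Set.indicator_of_mem hxB]
      have := mul_le_mul_of_nonneg_left (neg_two_mul_exp_le_excess (u := inner ℝ x θ) h0 h1
        (sq_nonneg ‖x‖) (hmem.1 hxB).le) hZ0
      linarith
    · have hk : k = 0 := h2 (not_lt.1 fun h => hxB (hmem.2 h))
      rw [Set.indicator_of_notMem hxB, hD, hk]
      simp

end Estimator

/-! ### The contribution of the box and the growth of the risk -/

section Excess

variable {p : ℕ} {φ φ' : ℝ → ℝ} {a : ℝ}

/-- The constant in the lower bound `excessConst * e ^ (√a t) / t ^ (γ + (p - 1) / 2)` for the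
contribution of the box along `θ` to the risk, where `t = ‖θ‖`. -/
noncomputable def excessConst (p : ℕ) (a c γ : ℝ) : ℝ :=
  c / a * √a * (√a / 2) ^ γ * Real.exp (-2 - a / 2) * (2 * √(√a / p)) ^ (p - 1)

theorem excessConst_pos (hp : 1 ≤ p) (ha : 0 < a) {c γ : ℝ} (hc : 0 < c) :
    0 < excessConst p a c γ := by
  have h1 : 0 < √a := Real.sqrt_pos.2 ha
  have h2 : (0 : ℝ) < p := by exact_mod_cast hp
  have h3 : 0 < √(√a / p) := Real.sqrt_pos.2 (by positivity)
  unfold excessConst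
  positivity

/-- Elementary estimates for a point `x` of the box along `θ`, where `t = ‖θ‖`,
`y = ⟪x, θ⟫ / t` and `w = ‖x‖ ^ 2`. -/
theorem sub_bounds_of_mem_box {r t y w s : ℝ} (hr : 0 < r) (hs : s < r ^ 2) (ht1 : 4 / r ≤ t)
    (ht2 : 4 * r / (r ^ 2 - s) ≤ t) (hl : r - 2 / t < y) (hu : y < r - 1 / t)
    (hw1 : y ^ 2 ≤ w) (hw2 : w ≤ y ^ 2 + r / t) :
    0 < w ∧ s < w ∧ w < r ^ 2 ∧ r / 2 / t ≤ r ^ 2 - w := by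
  have h4 : 0 < 4 / r := by positivity
  have ht : 0 < t := h4.trans_le ht1
  have hrt : 4 ≤ t * r := (div_le_iff₀ hr).1 ht1
  have hst : 4 * r ≤ t * (r ^ 2 - s) := (div_le_iff₀ (by linarith)).1 ht2
  -- With `v = 1/t`, `w < (r - v)² + rv = r² - rv + v²`, and `4v ≤ r` leaves a gap of at least
  -- `rv/2`.
  obtain ⟨v, hv⟩ : ∃ v, v = 1 / t := ⟨_, rfl⟩
  have hv0 : 0 < v := by rw [hv]; positivity
  have htv : t * v = 1 := by rw [hv]; field_simp
  have e2 : 2 / t = 2 * v := by rw [hv]; ring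
  have e3 : r / t = r * v := by rw [hv]; ring
  have e4 : r / 2 / t = r * v / 2 := by rw [hv]; ring
  rw [e2] at hl
  rw [← hv] at hu
  rw [e3] at hw2
  rw [e4]
  have hrv : 4 * v ≤ r := by nlinarith
  have hsv : 4 * r * v ≤ r ^ 2 - s := by nlinarith
  have hy0 : 0 < y := by linarith
  have hyl : (r - 2 * v) ^ 2 < y ^ 2 := by nlinarith
  have hyu : y ^ 2 < (r - v) ^ 2 := by nlinarith
  have hvv : 4 * (v * v) ≤ r * v := by nlinarith
  refine ⟨by nlinarith, by nlinarith, by nlinarith, by nlinarith⟩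

theorem IsDebiasedFactor.le_risk_of_mul_rpow_le (hp : 1 ≤ p) (ha : 0 < a)
    (hφ : IsDebiasedFactor φ φ' a) {c γ s : ℝ} (hc : 0 < c) (hγ : 0 ≤ γ) (hs : s < a)
    (hb : ∀ᵐ w, w ∈ Set.Ioo s a → c * (a - w) ^ γ ≤ φ w)
    (θ : EuclideanSpace ℝ (Fin p)) (ht1 : 4 / √a ≤ ‖θ‖) (ht2 : 4 * √a / (a - s) ≤ ‖θ‖)
    (ht3 : 2 * (2 + a) / √a ≤ ‖θ‖) :
    ENNReal.ofReal (p + Real.exp (-‖θ‖ ^ 2 / 2) / (2 * Real.pi) ^ ((p : ℝ) / 2) *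
      (excessConst p a c γ * (Real.exp (√a * ‖θ‖) / ‖θ‖ ^ (γ + ((p : ℝ) - 1) / 2)) -
        2 * Real.exp (a / 2) *
        volume.real (Metric.ball (0 : EuclideanSpace ℝ (Fin p)) (√a)))) ≤
      risk (shrinkageEstimator p φ) θ := by
  have : Nonempty (Fin p) := ⟨⟨0, hp⟩⟩
  have hp0 : (0 : ℝ) < p := by exact_mod_cast hp
  obtain ⟨r, hrdef⟩ : ∃ r, r = √a := ⟨_, rfl⟩
  have hr0 : 0 < r := hrdef ▸ Real.sqrt_pos.2 ha
  have hr2 : r ^ 2 = a := by rw [hrdef, Real.sq_sqrt ha.le]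
  unfold excessConst
  rw [← hrdef] at ht1 ht2 ht3 ⊢
  obtain ⟨t, htdef⟩ : ∃ t, t = ‖θ‖ := ⟨_, rfl⟩
  have h4 : 0 < 4 / r := by positivity
  rw [← htdef] at ht1 ht2 ht3 ⊢
  have ht : 0 < t := h4.trans_le ht1
  have he : ‖t⁻¹ • θ‖ = 1 := by
    rw [norm_smul, norm_inv, Real.norm_of_nonneg ht.le, ← htdef, inv_mul_cancel₀ ht.ne']
  -- Chosen so that the transverse part of `‖x‖²` is at most `r/t`, within the radial margin left by
  -- `y < r - 1/t`.
  set q := √(r / p) / √t with hq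
  have hq2 : p * q ^ 2 = r / t := by
    rw [hq, div_pow, Real.sq_sqrt (by positivity), Real.sq_sqrt ht.le]
    field_simp
  obtain ⟨A, hAm, hAv, hA⟩ := exists_box_along hp he (l := r - 2 / t) (r := r - 1 / t) (q := q)
    (by have : 1 / t ≤ 2 / t := by gcongr; norm_num
        linarith) (by positivity)
  -- The factors bound `k`, `⟪x, θ⟫ - ‖x‖²` and the exponential weight from below, using `⟪x, θ⟫ >
  -- rt - 2` and `‖x‖² < a` on the box. The third threshold on `t` gives `rt - 2 - a ≥ rt/2`.
  set m := 2 * (c * (r / 2 / t) ^ γ / a) * (r * t / 2) * Real.exp (r * t - 2 - a / 2) with hm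
  have hAr : volume.real A = 1 / t * (2 * q) ^ (p - 1) := by
    rw [Measure.real, hAv, ENNReal.toReal_ofReal]
    · congr 1; ring
    · have : (r - 1 / t - (r - 2 / t)) = 1 / t := by ring
      rw [this]; positivity
  have key := hφ.le_risk hp ha θ hAm (by rw [hAv]; exact ENNReal.ofReal_ne_top) (m := m) ?_
  · have e : m * volume.real A = c / a * r * (r / 2) ^ γ * Real.exp (-2 - a / 2) *
        (2 * √(r / p)) ^ (p - 1) * (Real.exp (r * t) / t ^ (γ + ((p : ℝ) - 1) / 2)) := by
      have e1 : Real.exp (r * t - 2 - a / 2) = Real.exp (r * t) * Real.exp (-2 - a / 2) := by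
        rw [← Real.exp_add]; ring_nf
      have e2 : (2 * q) ^ (p - 1) = (2 * √(r / p)) ^ (p - 1) / t ^ (((p : ℝ) - 1) / 2) := by
        rw [hq, ← mul_div_assoc, div_pow]
        congr 1
        rw [Real.sqrt_eq_rpow, ← Real.rpow_natCast, ← Real.rpow_mul ht.le, Nat.cast_sub hp]
        congr 1; push_cast; ring
      have e3 : (r / 2 / t) ^ γ = (r / 2) ^ γ / t ^ γ := Real.div_rpow (by positivity) ht.le _
      have h5 : 0 < t ^ γ := Real.rpow_pos_of_pos ht _
      have h6 : 0 < t ^ (((p : ℝ) - 1) / 2) := Real.rpow_pos_of_pos ht _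
      rw [hm, hAr, e1, e2, e3, Real.rpow_add ht]
      field_simp
    rw [e, ← hrdef, ← htdef] at key
    exact key
  · have hP := ae_norm_sq_of_ae_Ioi (volume : Measure (EuclideanSpace ℝ (Fin p)))
      (P := fun w => w ∈ Set.Ioo s a → c * (a - w) ^ γ ≤ φ w)
      (by filter_upwards [hb] with w hw _ using hw)
    filter_upwards [hP] with x hx hxA
    obtain ⟨h1, h2, h3, h4'⟩ := hA x hxA
    rw [hq2] at h4'
    obtain ⟨hw0, hws, hwa, hd⟩ := sub_bounds_of_mem_box hr0 (hr2 ▸ hs) ht1 (hr2 ▸ ht2) h1 h2 h3 h4'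
    rw [hr2] at hwa hd
    have hin : inner ℝ x (t⁻¹ • θ) = inner ℝ x θ / t := by
      rw [real_inner_smul_right]; ring
    rw [hin, lt_div_iff₀ ht, sub_mul, div_mul_cancel₀ _ ht.ne'] at h1
    have hφw := hx ⟨hws, hwa⟩
    have h7 : c * (r / 2 / t) ^ γ ≤ φ (‖x‖ ^ 2) :=
      (mul_le_mul_of_nonneg_left (Real.rpow_le_rpow (by positivity) hd hγ) hc.le).trans hφw
    have h8 : 0 < c * (r / 2 / t) ^ γ := by positivity
    have h9 : c * (r / 2 / t) ^ γ / a ≤ φ (‖x‖ ^ 2) / ‖x‖ ^ 2 :=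
      div_le_div₀ (h8.le.trans h7) h7 hw0 hwa.le
    set k := φ (‖x‖ ^ 2) / ‖x‖ ^ 2
    have hk0 : 0 < c * (r / 2 / t) ^ γ / a := by positivity
    have h10 : 2 * (2 + a) ≤ t * r := (div_le_iff₀ hr0).1 ht3
    have h11 : r * t / 2 ≤ inner ℝ x θ - ‖x‖ ^ 2 := by linarith
    have h12 : Real.exp (r * t - 2 - a / 2) ≤ Real.exp (inner ℝ x θ - ‖x‖ ^ 2 / 2) :=
      Real.exp_le_exp.2 (by linarith)
    have h13 : 0 ≤ k ^ 2 * ‖x‖ ^ 2 := by positivity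
    have h14 : 2 * (c * (r / 2 / t) ^ γ / a) * (r * t / 2) ≤
        2 * k * (inner ℝ x θ - ‖x‖ ^ 2) :=
      mul_le_mul (by linarith) h11 (by positivity) (by linarith)
    rw [hm]
    exact mul_le_mul (by linarith) h12 (Real.exp_pos _).le
      (le_trans (by positivity) (h14.trans (le_add_of_nonneg_right h13)))

theorem IsDebiasedFactor.riskExcess_of_mul_rpow_le (hp : 1 ≤ p) (ha : 0 < a)
    (hφ : IsDebiasedFactor φ φ' a) {c γ s : ℝ} (hc : 0 < c) (hγ : 0 ≤ γ) (hs : s < a)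
    (hb : ∀ᵐ w, w ∈ Set.Ioo s a → c * (a - w) ^ γ ≤ φ w) :
    RiskExcess (shrinkageEstimator p φ) a (γ - 1) := by
  have hC := excessConst_pos (p := p) (γ := γ) hp ha hc
  set C := excessConst p a c γ with hCdef
  set L := 2 * Real.exp (a / 2) * volume.real (Metric.ball (0 : EuclideanSpace ℝ (Fin p)) (√a))
    with hL
  set d := γ + ((p : ℝ) - 1) / 2 with hd
  have hpi : (0 : ℝ) < (2 * Real.pi) ^ ((p : ℝ) / 2) := by positivity
  -- Beyond `N` the exponential beats the power, so the bounded loss `L` absorbs at most half of the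
  -- main term.
  obtain ⟨N, hN⟩ := eventually_atTop.1 (((tendsto_exp_mul_div_rpow_atTop d (√a)
    (Real.sqrt_pos.2 ha)).eventually_ge_atTop (2 * L / C)).and
    ((eventually_ge_atTop (4 / √a)).and ((eventually_ge_atTop (4 * √a / (a - s))).and
      (eventually_ge_atTop (2 * (2 + a) / √a)))))
  refine ⟨C / 2 / (2 * Real.pi) ^ ((p : ℝ) / 2), by positivity, (max N 1) ^ 2,
    by positivity, fun θ hθ => ?_⟩
  have hθ1 : max N 1 ≤ ‖θ‖ := le_of_sq_le_sq hθ (norm_nonneg _)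
  have ht : 0 < ‖θ‖ := zero_lt_one.trans_le ((le_max_right _ _).trans hθ1)
  obtain ⟨h1, h2, h3, h4⟩ := hN ‖θ‖ ((le_max_left _ _).trans hθ1)
  refine le_trans (ENNReal.ofReal_le_ofReal ?_)
    (hφ.le_risk_of_mul_rpow_le hp ha hc hγ hs hb θ h2 h3 h4)
  rw [← hCdef, ← hL, ← hd]
  have hx : excessOrder p a (γ - 1) (‖θ‖ ^ 2) =
      Real.exp (-‖θ‖ ^ 2 / 2) * (Real.exp (√a * ‖θ‖) / ‖θ‖ ^ d) := by
    unfold excessOrder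
    -- Passing from `t` to `ν = t²` halves the exponent: `d / 2 = (p + 1)/4 + (γ - 1)/2`, whence `b
    -- = γ - 1`.
    have e1 : (‖θ‖ ^ 2) ^ (((p : ℝ) + 1) / 4 + (γ - 1) / 2) = ‖θ‖ ^ d := by
      rw [← Real.rpow_natCast, ← Real.rpow_mul ht.le, hd]
      congr 1; push_cast; ring
    rw [e1, Real.sqrt_sq ht.le, neg_div, Real.exp_neg, mul_comm ‖θ‖]
    have := Real.exp_pos (‖θ‖ ^ 2 / 2)
    have := Real.rpow_pos_of_pos ht d
    field_simp
  rw [hx]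
  set Y := Real.exp (√a * ‖θ‖) / ‖θ‖ ^ d
  have h5 : L ≤ C * Y / 2 := by
    rw [div_le_iff₀ hC] at h1
    linarith
  have h6 : 0 ≤ Real.exp (-‖θ‖ ^ 2 / 2) / (2 * Real.pi) ^ ((p : ℝ) / 2) := by positivity
  have h7 := mul_le_mul_of_nonneg_left (show C * Y / 2 ≤ C * Y - L by linarith) h6
  have e : C / 2 / (2 * Real.pi) ^ ((p : ℝ) / 2) * (Real.exp (-‖θ‖ ^ 2 / 2) * Y) =
      Real.exp (-‖θ‖ ^ 2 / 2) / (2 * Real.pi) ^ ((p : ℝ) / 2) * (C * Y / 2) := by ring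
  rw [e]
  linarith

theorem RiskExcess.not_isMinimax (hp : 1 ≤ p) {b : ℝ}
    {δ : EuclideanSpace ℝ (Fin p) → EuclideanSpace ℝ (Fin p)} (h : RiskExcess δ a b) :
    ¬ IsMinimax δ := by
  intro hmm
  obtain ⟨c, hc, N, hN, hr⟩ := h
  have h1 := hmm id aemeasurable_id
  simp_rw [risk_id hp, ciSup_const] at h1
  -- One mean with `‖θ‖² = N` suffices, since its risk already exceeds `p`, the maximal risk of the
  -- identity.
  let θ : EuclideanSpace ℝ (Fin p) := EuclideanSpace.single ⟨0, hp⟩ (√N)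
  have hθ : ‖θ‖ ^ 2 = N := by simp [θ, Real.sq_sqrt hN.le]
  have h2 := (hr θ hθ.ge).trans ((le_iSup (risk δ) θ).trans h1)
  rw [hθ, ← ENNReal.ofReal_natCast, ENNReal.ofReal_le_ofReal_iff (by positivity)] at h2
  have : 0 < excessOrder p a b N := by unfold excessOrder; positivity
  nlinarith [mul_pos hc this]

end Excess

theorem theorem2 (p : ℕ) (hp : 1 ≤ p) (φ φ' : ℝ → ℝ) (a : ℝ) (ha : 0 < a)
    (hφ : IsDebiasedFactor φ φ' a) :
    ((NegativeSlope φ' a ∨ ∃ γ : ℝ, FlatContact φ φ' a γ) →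
      ¬ IsMinimax (shrinkageEstimator p φ)) ∧
    (∀ θ, risk (shrinkageEstimator p φ) θ ≠ ⊤) ∧
    (NegativeSlope φ' a → RiskExcess (shrinkageEstimator p φ) a 0) ∧
    (∀ γ : ℝ, FlatContact φ φ' a γ → RiskExcess (shrinkageEstimator p φ) a (γ - 1)) := by
  have slope : NegativeSlope φ' a → RiskExcess (shrinkageEstimator p φ) a 0 := by
    intro h
    obtain ⟨c, hc, s, hs, hb⟩ := h.exists_mul_le ha hφ
    -- A negative slope is contact of order `γ = 1`, giving `b = 0`.
    have := hφ.riskExcess_of_mul_rpow_le hp ha (γ := 1) hc zero_le_one hs (by simpa using hb)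
    simpa using this
  have flat : ∀ γ : ℝ, FlatContact φ φ' a γ →
      RiskExcess (shrinkageEstimator p φ) a (γ - 1) := by
    intro γ h
    obtain ⟨c, hc, s, hs, hb⟩ := h.exists_mul_rpow_le ha hφ
    exact hφ.riskExcess_of_mul_rpow_le hp ha hc (by linarith [h.one_lt]) hs hb
  refine ⟨?_, fun θ => ?_, slope, flat⟩
  · rintro (h | ⟨γ, h⟩)
    · exact (slope h).not_isMinimax hp
    · exact (flat γ h).not_isMinimax hp
  · rw [hφ.risk_eq hp ha θ]
    exact ENNReal.ofReal_ne_top
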